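/- Let $G=(V,E)$ be a finite connected graph (loops and multiple edges allowed), cellularly embedded on a closed, connected, orientable surface $\Sigma$ of genus $g$, with set of faces $F$; the embedding is presented, as usual, by its rotation system (the cyclic counterclockwise order of the edge-ends around each vertex), the faces being the cycles of the face-tracing permutation and the genus being determined by $|V|-|E|+|F|=2-2g$. A single vertex without edges, on the sphere, is allowed. Let $G^*$ be the dual graph, whose vertices are the faces of $G$ and whose edge set is identified with $E$. *The game.* Consider the colorings of the edges of $G$ by two colors. Two colorings are equivalent if one is obtained from the other by a finite sequence of the following moves: (1) for a vertex, switch the colors of all edges with exactly one end at that vertex; (2) for a face, switch the colors of all edges that occur exactly once in the boundary walk of that face. *Notation.* Let $U,U^*\subseteq \mathrm{GF}(2)^E$ be the row spaces of the incidence matrices over $\mathrm{GF}(2)$ of $G$ and $G^*$ (loops contribute $0$), and let $U^\perp$ be the orthogonal complement of $U$ for the standard inner product $\langle\cdot,\cdot\rangle$, i.e. the cycle space of $G$. Let $\varphi:U^\perp\to H_1(\Sigma,\mathrm{GF}(2))$ be the map that sends a cycle to its homology class, where $H_1(\Sigma,\mathrm{GF}(2))$ is the first cellular homology group of the cell structure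 with cells $V,E,F$. The medial graph of $G$ is the 4-valent graph on $\Sigma$ with one vertex on each edge of $G$ and one edge across each corner of $G$; its components are the closed curves that go straight on at each of its vertices. Each component gives a vector in $\mathrm{GF}(2)^E$ that records, modulo 2, how often the component passes through each edge of $G$; let $\mathcal P$ be the span of these vectors. It is contained in $U^\perp$. Put $b=\dim\ker(\varphi|_{\mathcal P})$. **Theorem.** The integer $2-(|V|-|E|+|F|)$ is even and nonnegative, so that $g$ is a well-defined natural number, and the number of equivalence classes of colorings is $2^{2g+b}$. Moreover, $$\dim \mathrm{GF}(2)^E/(U+U^*)=2g+\dim(U\cap U^*)\qquad\text{and}\qquad \ker(\varphi|_{\mathcal P})=U\cap U^*.$$ Furthermore, there are a spanning tree $T$ of $G$ and a spanning tree $C$ of $G^*$ with $T\cap C=\emptyset$, and for any such $T$ and $C$: exactly $2g$ edges $e_1,\dots,e_{2g}$ lie in neither $T$ nor $C$; for each $j$ there is exactly one cycle $p_j$ of $G^*$ with edges in $C\cup\{e_j\}$ (a nonzero element of $(U^*)^\perp$ supported there); and there is an isomorphism $H_1(\Sigma,\mathrm{GF}(2))\cong\mathrm{GF}(2)^{2g}$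 under which $\varphi(u)=(\langle p_1,u\rangle,\dots,\langle p_{2g},u\rangle)$ for all $u\in U^\perp$. -/

import Mathlib

noncomputable section

/-- A multigraph (loops and multiple edges allowed) with vertex set `X` and edge set `E`:
`endpt e false` and `endpt e true` are the two ends of the edge `e`. -/
structure Multigraph (X E : Type*) where
  endpt : E → Bool → X

namespace Multigraph

variable {X E : Type*} (G : Multigraph X E)

/-- Two vertices are joined by an edge of `S`. -/
def AdjIn (S : Set E) (x y : X) : Prop :=
  ∃ e ∈ S, ∃ b, G.endpt e b = x ∧ G.endpt e (!b) = y

/-- Two vertices are joined by a walk all of whose edges lie in `S`. -/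
def ReachableIn (S : Set E) : X → X → Prop :=
  Relation.ReflTransGen (G.AdjIn S)

/-- The multigraph is (nonempty and) connected. -/
def Connected : Prop :=
  Nonempty X ∧ ∀ x y, G.ReachableIn Set.univ x y

/-- `T` is the edge set of a spanning tree: the edges of `T` connect all the vertices, and
`T` has no cycle, i.e. the ends of an edge of `T` are not joined within `T` without it. -/
def IsSpanningTree (T : Set E) : Prop :=
  (∀ x y, G.ReachableIn T x y) ∧
    ∀ e ∈ T, ¬ G.ReachableIn (T \ {e}) (G.endpt e false) (G.endpt e true)

open Classical in
/-- The row of the incidence matrix over `GF(2)` at the vertex `x`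
(a loop at `x` is counted twice, so it gets the entry `0`). -/
def incidenceRow (x : X) : E → ZMod 2 :=
  fun e => ∑ b : Bool, if G.endpt e b = x then 1 else 0

/-- The cocycle space (cut space): the row space of the incidence matrix. -/
def cocycleSpace : Submodule (ZMod 2) (E → ZMod 2) :=
  Submodule.span (ZMod 2) (Set.range G.incidenceRow)

/-- The edges with exactly one of their two ends at `x`. -/
def edgesOnceAt (x : X) : Set E := {e | ∃! b, G.endpt e b = x}

end Multigraph

/-- The orthogonal complement in `GF(2)^E` for the standard inner product. -/
def orth {E : Type*} [Fintype E] (W : Submodule (ZMod 2) (E → ZMod 2)) :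
    Submodule (ZMod 2) (E → ZMod 2) where
  carrier := {u | ∀ w ∈ W, w ⬝ᵥ u = 0}
  add_mem' := by
    intro a b ha hb w hw
    rw [dotProduct_add, ha w hw, hb w hw, add_zero]
  zero_mem' := by
    intro w _
    simp
  smul_mem' := by
    intro c a ha w hw
    rw [dotProduct_smul, ha w hw, smul_zero]

/-- The vector `p` is a cycle of the multigraph `G` whose edges belong to `C ∪ {e}`:
a nonzero element of the cycle space supported in `C ∪ {e}`.
(If `C` is a spanning tree and `e` is not in `C`, there is exactly one such cycle.) -/
def Multigraph.IsCycleIn {X E : Type*} [Fintype E] (G : Multigraph X E) (C : Set E) (e : E)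
    (p : E → ZMod 2) : Prop :=
  p ∈ orth G.cocycleSpace ∧ p ≠ 0 ∧ ∀ a, p a ≠ 0 → a ∈ C ∪ {e}

/-- The half-edge (dart) opposite to a given one. The darts of a multigraph are the pairs
`(e, b)`; the dart `(e, b)` runs along `e` from its end `b` to its end `!b`. -/
def oppDart {E : Type*} : Equiv.Perm (E × Bool) :=
  Equiv.prodCongr (Equiv.refl E) Equiv.boolNot

/-- A connected graph with vertex set `V` and edge set `E`, cellularly embedded on a closed
oriented surface with set of faces `F`, given by its rotation system.

* `rot` sends a dart to the next dart, counterclockwise, around its origin; thus the vertices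
  correspond to the cycles of `rot`.
* `face d` is the face on the left of the dart `d`. Someone who walks along `d` with that face
  on the left continues with the dart `rot⁻¹ (oppDart d)`; thus the faces correspond to the
  cycles of `rot⁻¹ * oppDart`, and these cycles are the boundary walks of the faces.
* If there is no edge, then the graph is one vertex on the sphere, with a single face. -/
structure CellularEmbedding (V E F : Type*) where
  origin : E × Bool → V
  rot : Equiv.Perm (E × Bool)
  origin_eq_iff : ∀ d d', origin d = origin d' ↔ rot.SameCycle d d'
  face : E × Bool → F
  face_eq_iff : ∀ d d', face d = face d' ↔ (rot⁻¹ * oppDart).SameCycle d d'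
  face_surjective : Nonempty E → Function.Surjective face
  card_face_of_isEmpty : IsEmpty E → Nat.card F = 1
  connected : (Multigraph.mk fun e b => origin (e, b)).Connected

namespace CellularEmbedding

variable {V E F : Type*} (M : CellularEmbedding V E F)

/-- The underlying graph `G`. -/
def graph : Multigraph V E := ⟨fun e b => M.origin (e, b)⟩

/-- The dual graph `G*`: its vertices are the faces of `G`, and the dual edge of `e` joins the
two faces on the two sides of `e`. The edge sets of `G` and `G*` are identified. -/
def dual : Multigraph F E := ⟨fun e b => M.face (e, b)⟩

/-- The cocycle space `U` of the graph. -/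
abbrev U : Submodule (ZMod 2) (E → ZMod 2) := M.graph.cocycleSpace

/-- The cocycle space `U*` of the dual graph. -/
abbrev Ustar : Submodule (ZMod 2) (E → ZMod 2) := M.dual.cocycleSpace

/-- The Euler characteristic of the surface. -/
def eulerChar (_M : CellularEmbedding V E F) : ℤ := (Nat.card V : ℤ) - Nat.card E + Nat.card F

/-- The genus of the surface, i.e. the number `g` with Euler characteristic `2 - 2 g`. -/
def genus : ℕ := ((2 - M.eulerChar) / 2).toNat

/-! ### The color changing game -/

/-- Switch the colors of the edges in `S`. -/
def switch (S : Set E) (c : E → Bool) : E → Bool :=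
  open Classical in fun e => if e ∈ S then !(c e) else c e

/-- One move of the game: around a vertex, switch the colors of the edges with exactly one end
at that vertex; or, around a face, switch the colors of the edges that occur exactly once in
the boundary walk of that face. -/
inductive Move : (E → Bool) → (E → Bool) → Prop
  | vertex (v : V) (c : E → Bool) : Move c (switch (M.graph.edgesOnceAt v) c)
  | face (f : F) (c : E → Bool) : Move c (switch (M.dual.edgesOnceAt f) c)

theorem switch_switch (S : Set E) (c : E → Bool) : switch S (switch S c) = c := by
  funext e
  by_cases h : e ∈ S <;> simp [switch, h]

theorem move_symm {c c' : E → Bool} (h : M.Move c c') : M.Move c' c := by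
  cases h with
  | vertex v c =>
    have h := Move.vertex (M := M) v (switch (M.graph.edgesOnceAt v) c)
    rwa [switch_switch] at h
  | face f c =>
    have h := Move.face (M := M) f (switch (M.dual.edgesOnceAt f) c)
    rwa [switch_switch] at h

/-- Two bicolorings are equivalent if one is obtained from the other by finitely many moves. -/
def coloringSetoid : Setoid (E → Bool) where
  r := Relation.ReflTransGen M.Move
  iseqv :=
    ⟨fun _ => Relation.ReflTransGen.refl,
     fun h => by
      induction h with
      | refl => exact Relation.ReflTransGen.refl
      | tail _ h ih => exact Relation.ReflTransGen.head (M.move_symm h) ih,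
     fun h h' => h.trans h'⟩

/-! ### The components of the medial graph

The medial graph has one (4-valent) vertex on every edge `e` of `G` and one arc across every
corner of `G`, i.e. across the angle between a dart `d` and the next dart `rot d`. Its
half-arcs are the pairs `(d, s)`: the half-arc which starts at the midpoint of the edge of `d`
and goes towards the origin of `d`, on the left of `d` if `s = true` and on the right of `d` if
`s = false`. -/

/-- Two half-arcs that follow each other on a component (a closed curve) of the medial graph. -/
inductive MedialStep : (E × Bool) × Bool → (E × Bool) × Bool → Prop
  /-- The arc across the corner between `d` and `rot d`. -/
  | corner (d : E × Bool) : MedialStep (d, true) (M.rot d, false)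
  /-- The curve goes straight on at the midpoint of an edge, from one side of the edge to the
  other (the left of `d` is the right of the opposite dart). -/
  | straight (d : E × Bool) (s : Bool) : MedialStep (d, s) (oppDart d, s)

/-- The components of the medial graph, as closed curves going straight on at each crossing. -/
def MedialComponent : Type _ := Quot M.MedialStep

/-- The component to which a half-arc belongs. -/
def medialComponent (x : (E × Bool) × Bool) : M.MedialComponent := Quot.mk _ x

open Classical in
/-- The vector of a component `k`: the number modulo 2 of the passages of `k` through each edge.
The two strands through the midpoint of `e` are indexed by `s : Bool`; the strand `s` consists
of the opposite half-arcs `((e, false), s)` and `((e, true), s)`. -/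
def medialVector (k : M.MedialComponent) : E → ZMod 2 :=
  fun e => ∑ s : Bool, if M.medialComponent ((e, false), s) = k then 1 else 0

/-- The space `P` generated by the vectors of the components of the medial graph. -/
def P : Submodule (ZMod 2) (E → ZMod 2) :=
  Submodule.span (ZMod 2) (Set.range M.medialVector)

/-! ### Homology of the surface with coefficients in `GF(2)`

The cell structure given by the embedded graph has the cells `V`, `E`, `F`. -/

section Homology

variable [Fintype E]

open Classical in
/-- The boundary of a 2-chain: a face is sent to the sum of the edges of its boundary walk. -/
def boundary₂ [Fintype F] : (F → ZMod 2) →ₗ[ZMod 2] (E → ZMod 2) where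
  toFun x := fun e => ∑ f, x f * ∑ b : Bool, if M.face (e, b) = f then 1 else 0
  map_add' x y := by
    funext e
    simp [add_mul, Finset.sum_add_distrib]
  map_smul' c x := by
    funext e
    simp [mul_assoc, Finset.mul_sum]

open Classical in
/-- The boundary of a 1-chain: an edge is sent to the sum of its two ends. -/
def boundary₁ : (E → ZMod 2) →ₗ[ZMod 2] (V → ZMod 2) where
  toFun x := fun v => ∑ e, x e * ∑ b : Bool, if M.origin (e, b) = v then 1 else 0
  map_add' x y := by
    funext e
    simp [add_mul, Finset.sum_add_distrib]
  map_smul' c x := by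
    funext e
    simp [mul_assoc, Finset.mul_sum]

/-- The first homology group of the surface with coefficients in `GF(2)`: cellular 1-cycles
modulo cellular 1-boundaries. -/
abbrev H₁ [Fintype F] : Type _ :=
  LinearMap.ker M.boundary₁ ⧸
    (LinearMap.range M.boundary₂).comap (LinearMap.ker M.boundary₁).subtype

theorem orth_U_le : orth M.U ≤ LinearMap.ker M.boundary₁ := by
  intro u hu
  rw [LinearMap.mem_ker]
  funext v
  have h := hu _ (Submodule.subset_span ⟨v, rfl⟩)
  simp only [dotProduct] at h
  rw [Pi.zero_apply, ← h]
  exact Finset.sum_congr rfl fun e _ => mul_comm _ _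

/-- The map `φ : U^⊥ → H₁(Σ, GF(2))` that sends a cycle to its homology class. -/
def φ [Fintype F] : orth M.U →ₗ[ZMod 2] M.H₁ :=
  (Submodule.mkQ _).comp (Submodule.inclusion M.orth_U_le)

theorem P_le_orth_U : M.P ≤ orth M.U := by
  classical
  refine Submodule.span_le.2 ?_
  rintro _ ⟨k, rfl⟩ w hw
  refine Submodule.span_induction (p := fun w _ => w ⬝ᵥ M.medialVector k = 0) ?_ ?_ ?_ ?_ hw
  · rintro _ ⟨v, rfl⟩
    let χ : (E × Bool) × Bool → ZMod 2 := fun x => if M.medialComponent x = k then 1 else 0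
    have hχ : ∀ d s, χ (oppDart d, s) = χ (d, s) := by
      intro d s
      have : M.medialComponent (oppDart d, s) = M.medialComponent (d, s) :=
        (Quot.sound (MedialStep.straight d s)).symm
      simp only [χ, this]
    have hrot : ∀ d, χ (d, true) = χ (M.rot d, false) := by
      intro d
      have : M.medialComponent (d, true) = M.medialComponent (M.rot d, false) :=
        Quot.sound (MedialStep.corner d)
      simp only [χ, this]
    have horg : ∀ d, M.origin (M.rot d) = M.origin d := fun d =>
      (M.origin_eq_iff _ _).2 (Equiv.Perm.SameCycle.refl M.rot d).apply_left
    have h1 : M.graph.incidenceRow v ⬝ᵥ M.medialVector k =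
        ∑ d : E × Bool, (if M.origin d = v then 1 else 0) * (χ (d, true) + χ (d, false)) := by
      rw [Fintype.sum_prod_type]
      refine Finset.sum_congr rfl fun e _ => ?_
      have ht := hχ (e, false) true
      have hf := hχ (e, false) false
      simp only [oppDart, Equiv.prodCongr_apply, Prod.map, Equiv.refl_apply,
        Equiv.boolNot_apply, Bool.not_false] at ht hf
      simp only [Multigraph.incidenceRow, medialVector, graph, Fintype.sum_bool, ht, hf]
      by_cases h₁ : M.origin (e, true) = v <;> by_cases h₂ : M.origin (e, false) = v <;>
        (simp [χ, h₁, h₂]; try ring)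
    have h2 : ∑ d : E × Bool, (if M.origin d = v then (1 : ZMod 2) else 0) * χ (d, true) =
        ∑ d : E × Bool, (if M.origin d = v then 1 else 0) * χ (d, false) := by
      refine Fintype.sum_equiv M.rot _ _ fun d => ?_
      rw [hrot, horg]
    rw [h1]
    simp only [mul_add, Finset.sum_add_distrib]
    rw [h2]
    exact CharTwo.add_self_eq_zero _
  · exact zero_dotProduct _
  · intro x y _ _ hx hy
    rw [add_dotProduct, hx, hy, add_zero]
  · intro c x _ hx
    rw [smul_dotProduct, hx, smul_zero]

/-- The restriction of `φ` to `P`. -/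
def φP [Fintype F] : M.P →ₗ[ZMod 2] M.H₁ :=
  M.φ.comp (Submodule.inclusion M.P_le_orth_U)

end Homology

/-- A spanning tree of the graph together with a spanning tree of the dual graph (the co-tree)
none of whose edges is dual to an edge of the tree. -/
structure TreeCotree where
  tree : Set E
  cotree : Set E
  isSpanningTree_tree : M.graph.IsSpanningTree tree
  isSpanningTree_cotree : M.dual.IsSpanningTree cotree
  disjoint : Disjoint tree cotree

/-- The edges that are neither in the tree nor in the co-tree. -/
def TreeCotree.Rest {M : CellularEmbedding V E F} (t : M.TreeCotree) : Type _ :=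
  {e : E // e ∉ t.tree ∧ e ∉ t.cotree}

end CellularEmbedding

end

/-!
Everything rests on two elementary facts about a rotation system. A function on darts that is
invariant under the rotation is a function of the vertices (`exists_eq_comp_origin`), and the face
on the left of a dart `d` is the face on the right of `rot d` (`face_oppDart_rot`).

**Trees.** For a spanning tree `T` of a connected graph over `GF(2)`, a cocycle is determined by its
values on `T`, these values are arbitrary, and a cycle supported in `T` vanishes; this gives the
fundamental cuts and fundamental cycles and `|T| = dim U = |V| - 1`. As `U* ≤ U^⊥`, the coboundary
of a component of `G* \ T` is a cycle supported in `T`, hence zero; so `G* \ T` is connected and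
contains a co-tree `C` (`nonempty_treeCotree`). Therefore exactly
`|E| - (|V| - 1) - (|F| - 1) = 2 - χ` edges are left over, which proves `χ ≤ 2`. That `χ` is even
follows from the signs of the rotation, the reversal of darts and the face permutation
(`even_card`). The dimension of `GF(2)^E / (U + U*)` is then linear algebra, and the classes of the
game are the elements of this quotient (`card_coloring_classes`).

**Homology.** The kernel of `φ` is `U*`. The intersection numbers with the fundamental cycles of
the co-tree are coordinates on the homology group, because the fundamental cycles of the tree at
the same edges form a dual basis (`TreeCotree.exists_coordinates`).

**Medial curves.** A curve that goes straight on at the midpoint of an edge passes from the corner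
`(v, f)` to the opposite corner `(v', f')`. If a vector is the coboundary of `α` on the graph and of
`β` on the dual graph, then `α v + β f` has the same value at both corners, and so the vector is a
sum of vectors of medial components. Conversely, for an element of `P ∩ U*` one recovers `α` by
subtracting `β` from the function of the corners given by the components. Hence
`ker (φ|P) = P ∩ U* = U ∩ U*` (`P_inf_Ustar`).
-/

/-! ### Cuts, cycles and spanning trees over `GF(2)` -/

namespace Multigraph

variable {X E : Type*} (G : Multigraph X E)

/-- The coboundary of a `0`-cochain `α`: its value at an edge is the sum of the values of `α` at
the two ends. -/
def coboundary : (X → ZMod 2) →ₗ[ZMod 2] (E → ZMod 2) where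
  toFun α e := α (G.endpt e false) + α (G.endpt e true)
  map_add' α β := by
    funext e
    simp only [Pi.add_apply]
    ring
  map_smul' c α := by
    funext e
    simp [mul_add]

theorem coboundary_apply (α : X → ZMod 2) (e : E) :
    G.coboundary α e = α (G.endpt e false) + α (G.endpt e true) := rfl

theorem coboundary_apply_dart (α : X → ZMod 2) (e : E) (b : Bool) :
    G.coboundary α e = α (G.endpt e b) + α (G.endpt e !b) := by
  cases b
  · rfl
  · exact add_comm _ _

theorem coboundary_eq_sum [Fintype X] (α : X → ZMod 2) :
    G.coboundary α = ∑ x, α x • G.incidenceRow x := by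
  classical
  funext e
  simp only [coboundary_apply, incidenceRow, Finset.sum_apply, Pi.smul_apply, smul_eq_mul,
    Fintype.sum_bool, mul_add, Finset.sum_add_distrib, mul_ite, mul_one, mul_zero,
    Finset.sum_ite_eq, Finset.mem_univ, if_true]
  exact add_comm _ _

theorem range_coboundary [Fintype X] : LinearMap.range G.coboundary = G.cocycleSpace := by
  ext w
  rw [LinearMap.mem_range, cocycleSpace, Submodule.mem_span_range_iff_exists_fun]
  simp only [coboundary_eq_sum]

theorem coboundary_mem [Fintype X] (α : X → ZMod 2) : G.coboundary α ∈ G.cocycleSpace :=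
  G.range_coboundary ▸ ⟨α, rfl⟩

theorem exists_coboundary [Fintype X] {w : E → ZMod 2} (hw : w ∈ G.cocycleSpace) :
    ∃ α, G.coboundary α = w := by
  rwa [← range_coboundary] at hw

variable {G}

theorem AdjIn.symm {S : Set E} {x y : X} (h : G.AdjIn S x y) : G.AdjIn S y x := by
  obtain ⟨e, he, b, rfl, rfl⟩ := h
  exact ⟨e, he, !b, rfl, by rw [Bool.not_not]⟩

theorem ReachableIn.symm {S : Set E} {x y : X} (h : G.ReachableIn S x y) :
    G.ReachableIn S y x :=
  by
  induction h with
  | refl => exact Relation.ReflTransGen.refl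
  | tail _ h ih => exact Relation.ReflTransGen.head h.symm ih

theorem eq_of_reachableIn {S : Set E} {α : X → ZMod 2} (hα : ∀ e ∈ S, G.coboundary α e = 0)
    {x y : X} (h : G.ReachableIn S x y) : α x = α y := by
  induction h with
  | refl => rfl
  | tail _ h ih =>
    obtain ⟨e, he, b, rfl, rfl⟩ := h
    have := hα e he
    rw [coboundary_apply_dart _ _ _ b, CharTwo.add_eq_zero] at this
    exact ih.trans this

open Classical in
/-- No edge of `S` leaves a component of `S`. -/
theorem coboundary_component (S : Set E) (x : X) {e : E} (he : e ∈ S) :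
    G.coboundary (fun y => if G.ReachableIn S x y then 1 else 0) e = 0 := by
  have h : G.ReachableIn S x (G.endpt e false) ↔ G.ReachableIn S x (G.endpt e true) :=
    ⟨fun h => h.tail ⟨e, he, false, rfl, rfl⟩, fun h => h.tail ⟨e, he, true, rfl, rfl⟩⟩
  rw [coboundary_apply]
  simp only [h]
  exact CharTwo.add_self_eq_zero _

/-- A cocycle is determined by its values on a connecting set of edges. -/
theorem cocycle_eq_zero [Fintype X] {S : Set E} (hS : ∀ x y, G.ReachableIn S x y)
    {w : E → ZMod 2} (hw : w ∈ G.cocycleSpace) (h0 : ∀ e ∈ S, w e = 0) : w = 0 := by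
  obtain ⟨α, rfl⟩ := G.exists_coboundary hw
  funext e
  rw [coboundary_apply, eq_of_reachableIn h0 (hS (G.endpt e false) (G.endpt e true))]
  exact CharTwo.add_self_eq_zero _

/-- The fundamental cut of an edge `e` of an acyclic set `T`: one side of it is the component of
an end of `e` in `T \ {e}`. -/
theorem exists_fundamental_cut [Fintype X] {T : Set E} {e : E}
    (hT : ¬ G.ReachableIn (T \ {e}) (G.endpt e false) (G.endpt e true)) :
    ∃ w ∈ G.cocycleSpace, w e = 1 ∧ ∀ f ∈ T, f ≠ e → w f = 0 := by
  classical
  refine ⟨_, G.coboundary_mem fun y =>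
    if G.ReachableIn (T \ {e}) (G.endpt e false) y then 1 else 0, ?_, fun f hf hfe =>
      coboundary_component _ _ ⟨hf, hfe⟩⟩
  have h : G.ReachableIn (T \ {e}) (G.endpt e false) (G.endpt e false) :=
    Relation.ReflTransGen.refl
  rw [coboundary_apply, if_neg hT, if_pos h, add_zero]

/-- A cycle supported in an acyclic set of edges is zero. -/
theorem cycle_eq_zero [Fintype X] [Fintype E] {T : Set E}
    (hT : ∀ e ∈ T, ¬ G.ReachableIn (T \ {e}) (G.endpt e false) (G.endpt e true))
    {u : E → ZMod 2} (hu : u ∈ orth G.cocycleSpace) (h0 : ∀ e, u e ≠ 0 → e ∈ T) : u = 0 := by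
  funext e
  by_contra he
  obtain ⟨w, hw, hwe, hwT⟩ := exists_fundamental_cut (hT e (h0 e he))
  refine he ?_
  have h := hu w hw
  rw [dotProduct, Finset.sum_eq_single e, hwe, one_mul] at h
  · exact h
  · intro f _ hfe
    by_cases hf : u f = 0
    · rw [hf, mul_zero]
    · rw [hwT f (h0 f hf) hfe, zero_mul]
  · exact fun h => absurd (Finset.mem_univ e) h

/-- A connecting set of edges contains a spanning tree, namely any minimal connecting subset. -/
theorem exists_isSpanningTree_subset [Finite E] {S : Set E} (hS : ∀ x y, G.ReachableIn S x y) :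
    ∃ T ⊆ S, G.IsSpanningTree T := by
  obtain ⟨T, hTS, hT⟩ :=
    (Set.toFinite {T : Set E | ∀ x y, G.ReachableIn T x y}).exists_le_minimal hS
  refine ⟨T, hTS, hT.1, fun e he h => ?_⟩
  have hc : ∀ x y, G.ReachableIn (T \ {e}) x y := by
    intro x y
    induction hT.1 x y with
    | refl => exact Relation.ReflTransGen.refl
    | tail _ hyz ih =>
      refine ih.trans ?_
      obtain ⟨f, hf, b, rfl, rfl⟩ := hyz
      by_cases hfe : f = e
      · subst hfe
        cases b
        · exact h
        · exact h.symm
      · exact Relation.ReflTransGen.single ⟨f, ⟨hf, hfe⟩, b, rfl, rfl⟩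
  exact (hT.2 hc Set.sdiff_subset he).2 rfl

namespace IsSpanningTree

variable [Fintype X] {T : Set E}

theorem exists_cocycle_eqOn [Fintype E] (hT : G.IsSpanningTree T) (u : E → ZMod 2) :
    ∃ w ∈ G.cocycleSpace, ∀ e ∈ T, w e = u e := by
  classical
  have h : ∀ e, ∃ w ∈ G.cocycleSpace, e ∈ T → w e = 1 ∧ ∀ f ∈ T, f ≠ e → w f = 0 := by
    intro e
    by_cases he : e ∈ T
    · obtain ⟨w, hw, h⟩ := exists_fundamental_cut (hT.2 e he)
      exact ⟨w, hw, fun _ => h⟩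
    · exact ⟨0, zero_mem _, fun h => absurd h he⟩
  choose w hw hwT using h
  refine ⟨∑ e ∈ Finset.univ.filter (· ∈ T), u e • w e,
    Submodule.sum_mem _ fun e _ => Submodule.smul_mem _ _ (hw e), fun f hf => ?_⟩
  rw [Finset.sum_apply, Finset.sum_eq_single f]
  · simp [(hwT f hf).1]
  · intro e he hef
    simp [(hwT e (by simpa using he)).2 f hf hef.symm]
  · intro h
    exact absurd (by simpa using hf) h

/-- Restriction to a spanning tree is an isomorphism from the cocycle space. -/
theorem finrank_cocycleSpace [Fintype E] (hT : G.IsSpanningTree T) :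
    Module.finrank (ZMod 2) G.cocycleSpace = Nat.card T := by
  classical
  let r : G.cocycleSpace →ₗ[ZMod 2] (T → ZMod 2) :=
    (LinearMap.funLeft (ZMod 2) (ZMod 2) ((↑) : T → E)).comp G.cocycleSpace.subtype
  have hr : Function.Bijective r := by
    constructor
    · rw [← LinearMap.ker_eq_bot, LinearMap.ker_eq_bot']
      intro w hw
      exact Subtype.ext (cocycle_eq_zero hT.1 w.2 fun e he => congrFun hw ⟨e, he⟩)
    · intro u
      obtain ⟨w, hw, h⟩ := hT.exists_cocycle_eqOn fun e => if h : e ∈ T then u ⟨e, h⟩ else 0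
      refine ⟨⟨w, hw⟩, funext fun e => ?_⟩
      have := h e e.2
      rwa [dif_pos e.2] at this
  rw [(LinearEquiv.ofBijective r hr).finrank_eq, Module.finrank_fintype_fun_eq_card,
    Nat.card_eq_fintype_card]

/-- The fundamental cycle of an edge `e` outside a spanning tree. Its value at an edge `f` of the
tree is the value at `e` of the fundamental cut of `f`. -/
theorem exists_fundamental_cycle [Fintype E] (hT : G.IsSpanningTree T) {e : E} (he : e ∉ T) :
    ∃ p ∈ orth G.cocycleSpace, p e = 1 ∧ ∀ a, p a ≠ 0 → a ∈ T ∪ {e} := by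
  classical
  have h : ∀ f, ∃ w ∈ G.cocycleSpace, ∀ a ∈ T, w a = (Pi.single f 1 : E → ZMod 2) a :=
    fun f => hT.exists_cocycle_eqOn _
  choose w hw hwT using h
  refine ⟨fun a => if a = e then 1 else if a ∈ T then w a e else 0, ?_, if_pos rfl, ?_⟩
  · intro v hv
    -- `v` is the combination of the fundamental cuts with its own values on `T` as coefficients.
    have hv' : v - ∑ f ∈ Finset.univ.filter (· ∈ T), v f • w f = 0 := by
      refine cocycle_eq_zero hT.1 (sub_mem hv (Submodule.sum_mem _ fun f _ =>
        Submodule.smul_mem _ _ (hw f))) fun a ha => ?_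
      rw [Pi.sub_apply, Finset.sum_apply, Finset.sum_eq_single a]
      · simp [hwT a a ha]
      · intro f _ hfa
        simp [hwT f a ha, hfa.symm]
      · intro h
        exact absurd (by simpa using ha) h
    have hve := congrFun (sub_eq_zero.1 hv') e
    rw [Finset.sum_apply] at hve
    have key : ∀ a, v a * (if a = e then 1 else if a ∈ T then w a e else 0) =
        (if a = e then v a else 0) + if a ∈ T then (v a • w a) e else 0 := by
      intro a
      by_cases hae : a = e
      · subst hae
        simp [he]
      · simp [hae]
    simp only [dotProduct, key, Finset.sum_add_distrib]
    rw [← Finset.sum_filter (p := (· ∈ T)), ← hve]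
    simp [CharTwo.add_self_eq_zero]
  · intro a ha
    by_cases hae : a = e
    · exact Or.inr hae
    · refine Or.inl ?_
      by_contra haT
      simp [hae, haT] at ha

theorem apply_eq_one_of_isCycleIn [Fintype E] (hT : G.IsSpanningTree T) {e : E} {p : E → ZMod 2}
    (hp : G.IsCycleIn T e p) : p e = 1 := by
  by_contra h
  have h0 : p e = 0 := by
    generalize p e = z at h
    revert z
    decide
  refine hp.2.1 (cycle_eq_zero hT.2 hp.1 fun a ha => (hp.2.2 a ha).resolve_right ?_)
  rintro rfl
  exact ha h0

theorem existsUnique_isCycleIn [Fintype E] (hT : G.IsSpanningTree T) {e : E} (he : e ∉ T) :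
    ∃! p : E → ZMod 2, G.IsCycleIn T e p := by
  obtain ⟨p, hp, hpe, hps⟩ := hT.exists_fundamental_cycle he
  have hp' : G.IsCycleIn T e p := ⟨hp, fun h => by simp [h] at hpe, hps⟩
  refine ⟨p, hp', fun q hq => ?_⟩
  have h := cycle_eq_zero hT.2 (sub_mem hq.1 hp) fun a ha => ?_
  · exact sub_eq_zero.1 h
  by_contra haT
  by_cases hae : a = e
  · subst hae
    simp [hT.apply_eq_one_of_isCycleIn hq, hpe] at ha
  · have h1 : q a = 0 := by
      by_contra h
      exact (hq.2.2 a h).elim haT hae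
    have h2 : p a = 0 := by
      by_contra h
      exact (hps a h).elim haT hae
    simp [h1, h2] at ha

end IsSpanningTree

/-- The kernel of the coboundary of a connected graph consists of the constants. -/
theorem finrank_cocycleSpace_add_one [Fintype X] [Nonempty X] {S : Set E}
    (hS : ∀ x y, G.ReachableIn S x y) :
    Module.finrank (ZMod 2) G.cocycleSpace + 1 = Nat.card X := by
  have hker : Module.finrank (ZMod 2) (LinearMap.ker G.coboundary) = 1 := by
    refine finrank_eq_one ⟨fun _ => 1, ?_⟩ ?_ fun α => ?_
    · funext e
      exact CharTwo.add_self_eq_zero _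
    · intro h
      exact one_ne_zero (congrFun (congrArg Subtype.val h) (Classical.arbitrary X))
    · refine ⟨α.1 (Classical.arbitrary X), Subtype.ext (funext fun x => ?_)⟩
      have h := eq_of_reachableIn (fun e _ => congrFun α.2 e) (hS (Classical.arbitrary X) x)
      simpa using h
  have h := LinearMap.finrank_range_add_finrank_ker G.coboundary
  rwa [range_coboundary, hker, Module.finrank_fintype_fun_eq_card,
    ← Nat.card_eq_fintype_card] at h

open Classical in
theorem incidenceRow_eq_indicator (x : X) (e : E) :
    G.incidenceRow x e = if e ∈ G.edgesOnceAt x then 1 else 0 := by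
  have h : e ∈ G.edgesOnceAt x ↔ ¬ (G.endpt e false = x ↔ G.endpt e true = x) := by
    simp only [edgesOnceAt, Set.mem_ofPred_eq, ExistsUnique, Bool.forall_bool, Bool.exists_bool]
    by_cases h₁ : G.endpt e false = x <;> by_cases h₂ : G.endpt e true = x <;> simp [h₁, h₂]
  rw [incidenceRow, Fintype.sum_bool]
  simp only [h]
  by_cases h₁ : G.endpt e false = x <;> by_cases h₂ : G.endpt e true = x <;>
    simp [h₁, h₂, CharTwo.add_self_eq_zero]

end Multigraph

/-! ### The sign of a permutation in terms of its number of cycles -/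

theorem Finset.card_image_eq_card_image_of_eq_iff {D A B : Type*} [DecidableEq A] [DecidableEq B]
    {s : Finset D} {f : D → A} {g : D → B}
    (h : ∀ x ∈ s, ∀ y ∈ s, f x = f y ↔ g x = g y) : (s.image f).card = (s.image g).card := by
  have hf : ((s.image fun x => (f x, g x)).image Prod.fst).card =
      (s.image fun x => (f x, g x)).card := by
    refine Finset.card_image_of_injOn fun p hp q hq hpq => ?_
    obtain ⟨x, hx, rfl⟩ := Finset.mem_image.1 hp
    obtain ⟨y, hy, rfl⟩ := Finset.mem_image.1 hq
    exact Prod.ext hpq ((h x hx y hy).1 hpq)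
  have hg : ((s.image fun x => (f x, g x)).image Prod.snd).card =
      (s.image fun x => (f x, g x)).card := by
    refine Finset.card_image_of_injOn fun p hp q hq hpq => ?_
    obtain ⟨x, hx, rfl⟩ := Finset.mem_image.1 hp
    obtain ⟨y, hy, rfl⟩ := Finset.mem_image.1 hq
    exact Prod.ext ((h x hx y hy).2 hpq) hpq
  rw [Finset.image_image] at hf hg
  exact hf.trans hg.symm

theorem Equiv.Perm.sign_eq_neg_one_pow_card_add_card {D X : Type*} [Fintype D] [DecidableEq D]
    [Fintype X] (σ : Equiv.Perm D) {π : D → X} (hπ : Function.Surjective π)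
    (h : ∀ d d', π d = π d' ↔ σ.SameCycle d d') :
    Equiv.Perm.sign σ = (-1) ^ (Fintype.card D + Fintype.card X) := by
  classical
  -- The cycles of length at least two.
  have h1 : (σ.support.image π).card = Multiset.card σ.cycleType := by
    have hc : σ.cycleFactorsFinset = σ.support.image σ.cycleOf := by
      ext c
      constructor
      · intro hc
        obtain ⟨x, hx⟩ := (Equiv.Perm.mem_cycleFactorsFinset_iff.1 hc).1.nonempty_support
        exact Finset.mem_image.2 ⟨x, Equiv.Perm.mem_cycleFactorsFinset_support_le hc hx,
          (Equiv.Perm.cycle_is_cycleOf hx hc).symm⟩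
      · intro hc
        obtain ⟨x, hx, rfl⟩ := Finset.mem_image.1 hc
        exact Equiv.Perm.cycleOf_mem_cycleFactorsFinset_iff.2 hx
    have hx : ∀ x ∈ σ.support, ∀ y ∈ σ.support, π x = π y ↔ σ.cycleOf x = σ.cycleOf y :=
      fun x hx y hy => (h x y).trans
        (Equiv.Perm.sameCycle_iff_cycleOf_eq_of_mem_support hx hy)
    rw [Equiv.Perm.cycleType_def, Multiset.card_map, Finset.card_val, hc]
    exact Finset.card_image_eq_card_image_of_eq_iff hx
  -- The fixed points.
  have h2 : (σ.supportᶜ.image π).card = σ.supportᶜ.card := by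
    refine Finset.card_image_of_injOn fun x hx y _ hxy => ?_
    have hx' : σ x = x := by simpa using hx
    exact ((h x y).1 hxy).eq_of_left hx'
  have h3 : _root_.Disjoint (σ.support.image π) (σ.supportᶜ.image π) := by
    rw [Finset.disjoint_left]
    intro v hv hv'
    obtain ⟨x, hx, rfl⟩ := Finset.mem_image.1 hv
    obtain ⟨y, hy, hxy⟩ := Finset.mem_image.1 hv'
    have hy' : σ y = y := by simpa using hy
    rw [((h y x).1 hxy).eq_of_left hy'] at hy
    exact Finset.mem_compl.1 hy hx
  have h4 : σ.support.image π ∪ σ.supportᶜ.image π = Finset.univ := by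
    rw [← Finset.image_union, Finset.union_compl, Finset.image_univ_of_surjective hπ]
  have h5 := Finset.card_union_of_disjoint h3
  rw [h4, h1, h2, Finset.card_univ] at h5
  have h6 := Finset.card_add_card_compl σ.support
  rw [Equiv.Perm.sign_of_cycleType, Equiv.Perm.sum_cycleType, h5, ← h6]
  have : ∀ a b c : ℕ, a + b + (c + b) = a + c + 2 * b := by intros; ring
  rw [this, pow_add _ _ (2 * _), pow_mul]
  simp

namespace CellularEmbedding

variable {V E F : Type*} (M : CellularEmbedding V E F)

/-! ### Darts, corners and the two incidence structures -/

theorem oppDart_oppDart (d : E × Bool) : oppDart (oppDart d) = d := by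
  obtain ⟨e, b⟩ := d
  simp [oppDart]

theorem origin_rot (d : E × Bool) : M.origin (M.rot d) = M.origin d :=
  (M.origin_eq_iff _ _).2 (Equiv.Perm.SameCycle.refl M.rot d).apply_left

/-- The face on the right of `rot d` is the face on the left of `d`: both contain the corner
between the two darts. -/
theorem face_oppDart_rot (d : E × Bool) : M.face (oppDart (M.rot d)) = M.face d := by
  refine (M.face_eq_iff _ _).2 ?_
  have h : (M.rot⁻¹ * oppDart : Equiv.Perm (E × Bool)) (oppDart (M.rot d)) = d := by
    simp [oppDart_oppDart]
  exact Equiv.Perm.SameCycle.symm ⟨-1, by rw [zpow_neg_one, Equiv.Perm.inv_eq_iff_eq, h]⟩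

theorem graph_coboundary_dart (α : V → ZMod 2) (d : E × Bool) :
    M.graph.coboundary α d.1 = α (M.origin d) + α (M.origin (oppDart d)) :=
  M.graph.coboundary_apply_dart α d.1 d.2

theorem dual_coboundary_dart (β : F → ZMod 2) (d : E × Bool) :
    M.dual.coboundary β d.1 = β (M.face d) + β (M.face (oppDart d)) :=
  M.dual.coboundary_apply_dart β d.1 d.2

/-- A function of the darts which is invariant under the rotation is a function of the origin. -/
theorem exists_eq_comp_origin {h : E × Bool → ZMod 2} (hh : ∀ d, h (M.rot d) = h d) :
    ∃ α : V → ZMod 2, ∀ d, α (M.origin d) = h d := by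
  have hf : Function.FactorsThrough h M.origin := by
    intro d d' hd
    obtain ⟨n, rfl⟩ := (M.origin_eq_iff _ _).1 hd
    have hz : ∀ n : ℤ, h ((M.rot ^ n) d) = h d := by
      intro n
      induction n with
      | zero => rfl
      | succ n ih => rw [add_comm, zpow_add, zpow_one, Equiv.Perm.mul_apply, hh, ih]
      | pred n ih =>
        rw [← ih, ← hh ((M.rot ^ (-(n : ℤ) - 1)) d), ← Equiv.Perm.mul_apply, ← zpow_one_add]
        congr 4
        ring
    exact (hz n).symm
  obtain ⟨α, hα⟩ := (Function.factorsThrough_iff h).1 hf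
  exact ⟨α, fun d => (congrFun hα d).symm⟩

theorem reachableIn_univ (x y : V) : M.graph.ReachableIn Set.univ x y := M.connected.2 x y

theorem nonempty_vertices (M : CellularEmbedding V E F) : Nonempty V := M.connected.1

theorem origin_surjective [Nonempty E] : Function.Surjective M.origin := by
  intro v
  let d : E × Bool := (Classical.arbitrary E, true)
  rcases Relation.ReflTransGen.cases_tail (M.reachableIn_univ (M.origin d) v) with h | h
  · exact ⟨d, h.symm⟩
  · obtain ⟨_, _, e, _, b, _, h⟩ := h
    exact ⟨(e, !b), h⟩

theorem nonempty_faces (M : CellularEmbedding V E F) : Nonempty F := by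
  cases isEmpty_or_nonempty E with
  | inl h => exact (Nat.card_pos_iff.1 (by rw [M.card_face_of_isEmpty h]; exact one_pos)).1
  | inr h => exact ⟨M.face (Classical.arbitrary E, true)⟩

theorem finrank_U_add_one [Fintype V] : Module.finrank (ZMod 2) M.U + 1 = Nat.card V :=
  have := M.nonempty_vertices
  Multigraph.finrank_cocycleSpace_add_one M.reachableIn_univ

/-- The dual graph is connected, in cohomological form: a function of the faces with zero
coboundary is constant. Indeed it defines a function of the darts that is invariant under the
rotation and under reversal, and the graph is connected. -/
theorem eq_of_dual_coboundary_eq_zero {β : F → ZMod 2} (hβ : M.dual.coboundary β = 0)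
    (x y : F) : β x = β y := by
  cases isEmpty_or_nonempty E with
  | inl h =>
    have := (Nat.card_eq_one_iff_unique.1 (M.card_face_of_isEmpty h)).1
    rw [Subsingleton.elim x y]
  | inr h =>
    have hopp : ∀ d, β (M.face (oppDart d)) = β (M.face d) := by
      intro d
      have := M.dual_coboundary_dart β d
      rw [hβ, Pi.zero_apply] at this
      exact (CharTwo.add_eq_zero.1 this.symm).symm
    obtain ⟨α, hα⟩ := M.exists_eq_comp_origin (h := fun d => β (M.face d)) fun d => by
      rw [← hopp, M.face_oppDart_rot]
    obtain ⟨d, rfl⟩ := M.face_surjective h x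
    obtain ⟨d', rfl⟩ := M.face_surjective h y
    rw [← hα d, ← hα d']
    refine Multigraph.eq_of_reachableIn (fun e _ => ?_)
      (M.reachableIn_univ (M.origin d) (M.origin d'))
    rw [M.graph_coboundary_dart α (e, true), hα, hα, hopp]
    exact CharTwo.add_self_eq_zero _

/-! ### The cocycle spaces of the graph and of its dual are orthogonal -/

theorem coboundary_dotProduct_dual_coboundary [Fintype E] (α : V → ZMod 2) (β : F → ZMod 2) :
    M.graph.coboundary α ⬝ᵥ M.dual.coboundary β = 0 := by
  -- As a sum over the darts, `β` is evaluated once on the left and once on the right of each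
  -- dart; the rotation exchanges the two sums.
  have h1 : M.graph.coboundary α ⬝ᵥ M.dual.coboundary β =
      ∑ d : E × Bool, α (M.origin d) * (β (M.face d) + β (M.face (oppDart d))) := by
    rw [Fintype.sum_prod_type]
    refine Finset.sum_congr rfl fun e _ => ?_
    rw [Fintype.sum_bool, M.graph_coboundary_dart α (e, true),
      M.dual_coboundary_dart β (e, true)]
    simp only [oppDart, Equiv.prodCongr_apply, Prod.map, Equiv.refl_apply,
      Equiv.boolNot_apply, Bool.not_true, Bool.not_false]
    ring
  have h2 : ∑ d : E × Bool, α (M.origin d) * β (M.face d) =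
      ∑ d : E × Bool, α (M.origin d) * β (M.face (oppDart d)) := by
    refine Fintype.sum_equiv M.rot _ _ fun d => ?_
    rw [M.origin_rot, M.face_oppDart_rot]
  rw [h1]
  simp only [mul_add, Finset.sum_add_distrib]
  rw [h2]
  exact CharTwo.add_self_eq_zero _

section

variable [Fintype V] [Fintype E] [Fintype F]

theorem Ustar_le_orth_U : M.Ustar ≤ orth M.U := by
  intro u hu w hw
  obtain ⟨α, rfl⟩ := M.graph.exists_coboundary hw
  obtain ⟨β, rfl⟩ := M.dual.exists_coboundary hu
  exact M.coboundary_dotProduct_dual_coboundary α β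

/-! ### Tree and co-tree -/

/-- The dual edges of the edges outside a spanning tree connect the faces: the coboundary of a
component is a cycle of the graph supported in the tree, hence zero. -/
theorem dual_reachableIn_compl {T : Set E} (hT : M.graph.IsSpanningTree T) (x y : F) :
    M.dual.ReachableIn Tᶜ x y := by
  classical
  let β : F → ZMod 2 := fun z => if M.dual.ReachableIn Tᶜ x z then 1 else 0
  have hβ : M.dual.coboundary β = 0 :=
    Multigraph.cycle_eq_zero hT.2 (M.Ustar_le_orth_U (M.dual.coboundary_mem β)) fun e he => by
      by_contra heT
      exact he (Multigraph.coboundary_component _ _ heT)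
  have hxx : M.dual.ReachableIn Tᶜ x x := Relation.ReflTransGen.refl
  have h := M.eq_of_dual_coboundary_eq_zero hβ x y
  by_contra hxy
  simp [β, hxx, hxy] at h

theorem nonempty_treeCotree : Nonempty M.TreeCotree := by
  obtain ⟨T, -, hT⟩ := Multigraph.exists_isSpanningTree_subset M.reachableIn_univ
  obtain ⟨C, hCT, hC⟩ :=
    Multigraph.exists_isSpanningTree_subset (M.dual_reachableIn_compl hT)
  exact ⟨⟨T, C, hT, hC, Set.disjoint_left.2 fun e he heC => hCT heC he⟩⟩

theorem finrank_Ustar_add_one : Module.finrank (ZMod 2) M.Ustar + 1 = Nat.card F := by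
  obtain ⟨t⟩ := M.nonempty_treeCotree
  have := M.nonempty_faces
  exact Multigraph.finrank_cocycleSpace_add_one t.isSpanningTree_cotree.1

variable {M} in
theorem TreeCotree.card_rest (t : M.TreeCotree) :
    Nat.card t.Rest + Module.finrank (ZMod 2) M.U + Module.finrank (ZMod 2) M.Ustar =
      Nat.card E := by
  rw [t.isSpanningTree_tree.finrank_cocycleSpace, t.isSpanningTree_cotree.finrank_cocycleSpace]
  have h : Nat.card t.Rest = ((t.tree ∪ t.cotree)ᶜ).ncard := by
    rw [← Nat.card_coe_set_eq]
    exact Nat.card_congr (Equiv.subtypeEquivRight fun e => by simp)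
  rw [h, Nat.card_coe_set_eq, Nat.card_coe_set_eq, add_assoc,
    ← Set.ncard_union_eq t.disjoint, add_comm, Set.ncard_add_ncard_compl]

/-! ### The Euler characteristic -/

/-- The parity of the Euler characteristic comes from the signs of the rotation, of the reversal
of darts, and of their product, the face permutation. -/
theorem even_card (M : CellularEmbedding V E F) :
    Even (Nat.card V + Nat.card E + Nat.card F) := by
  classical
  cases isEmpty_or_nonempty E with
  | inl h =>
    have h1 : Nat.card V = 1 := by
      have hV : Nonempty V := M.nonempty_vertices
      refine Nat.card_eq_one_iff_unique.2 ⟨⟨fun x y => ?_⟩, hV⟩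
      induction M.reachableIn_univ x y with
      | refl => rfl
      | tail _ h' _ => exact h.elim h'.choose
    rw [h1, M.card_face_of_isEmpty h, Nat.card_of_isEmpty]
    decide
  | inr h =>
    have hV := Equiv.Perm.sign_eq_neg_one_pow_card_add_card M.rot M.origin_surjective
      M.origin_eq_iff
    have hF := Equiv.Perm.sign_eq_neg_one_pow_card_add_card _ (M.face_surjective h)
      M.face_eq_iff
    have hE : Equiv.Perm.sign (oppDart : Equiv.Perm (E × Bool)) =
        (-1) ^ (Fintype.card (E × Bool) + Fintype.card E) := by
      refine Equiv.Perm.sign_eq_neg_one_pow_card_add_card _ (π := Prod.fst)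
        (fun e => ⟨(e, true), rfl⟩) ?_
      rintro ⟨e, b⟩ ⟨e', b'⟩
      constructor
      · rintro rfl
        by_cases hb : b = b'
        · rw [hb]
        · refine ⟨1, ?_⟩
          revert hb
          cases b <;> cases b' <;> simp [oppDart]
      · rintro ⟨n, hn⟩
        have hz : ∀ (n : ℤ) (d : E × Bool), ((oppDart ^ n) d).1 = d.1 := by
          intro n d
          induction n with
          | zero => rfl
          | succ n ih =>
            rw [add_comm, zpow_add, zpow_one, Equiv.Perm.mul_apply, ← ih]
            rfl
          | pred n ih =>
            rw [← ih, sub_eq_neg_add, zpow_add, zpow_neg_one, Equiv.Perm.mul_apply]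
            rfl
        rw [← hz n (e, b), hn]
    rw [Equiv.Perm.sign_mul, Equiv.Perm.sign_inv, hV, hE, ← pow_add] at hF
    have h2 : ((-1 : ℤˣ)) ^ (Fintype.card V + Fintype.card E + Fintype.card F) = 1 := by
      have h3 : ∀ a b : ℕ, ((-1 : ℤˣ)) ^ (a + 2 * b) = (-1) ^ a := fun a b => by
        rw [pow_add, pow_mul]
        simp
      have h4 := congrArg (· * (-1 : ℤˣ) ^ (Fintype.card (E × Bool) + Fintype.card F)) hF
      simp only [← pow_add] at h4
      have h5 : ∀ D V E F : ℕ, D + V + (D + E) + (D + F) =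
          (V + E + F + D) + 2 * D := by intros; ring
      rw [h5, h3, ← two_mul, ← zero_add (2 * _), h3, pow_zero, Fintype.card_prod,
        Fintype.card_bool, mul_comm, h3] at h4
      exact h4
    have h6 := neg_one_pow_eq_one_iff_even (R := ℤˣ) (by decide) |>.1 h2
    simpa only [Nat.card_eq_fintype_card] using h6

theorem eulerChar_eq : M.eulerChar = 2 - 2 * (M.genus : ℤ) := by
  obtain ⟨t⟩ := M.nonempty_treeCotree
  have h1 := t.card_rest
  have h2 := M.finrank_U_add_one
  have h3 := M.finrank_Ustar_add_one
  obtain ⟨k, hk⟩ := M.even_card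
  unfold genus eulerChar
  omega

theorem two_mul_genus_add :
    2 * M.genus + Module.finrank (ZMod 2) M.U + Module.finrank (ZMod 2) M.Ustar =
      Nat.card E := by
  have h1 := M.eulerChar_eq
  have h2 := M.finrank_U_add_one
  have h3 := M.finrank_Ustar_add_one
  unfold eulerChar at h1
  omega

variable {M} in
theorem TreeCotree.card_rest_eq_two_mul_genus (t : M.TreeCotree) :
    Nat.card t.Rest = 2 * M.genus := by
  have h1 := t.card_rest
  have h2 := M.two_mul_genus_add
  omega

theorem finrank_quotient_sup :
    Module.finrank (ZMod 2) ((E → ZMod 2) ⧸ (M.U ⊔ M.Ustar)) =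
      2 * M.genus + Module.finrank (ZMod 2) ↥(M.U ⊓ M.Ustar) := by
  have h1 := (M.U ⊔ M.Ustar).finrank_quotient_add_finrank
  have h2 := Submodule.finrank_sup_add_finrank_inf_eq M.U M.Ustar
  have h3 := M.two_mul_genus_add
  rw [Module.finrank_fintype_fun_eq_card, ← Nat.card_eq_fintype_card] at h1
  omega

end

/-! ### The equivalence classes of colorings -/

/-- A coloring as a vector over `GF(2)`. -/
def colorVector : (E → Bool) ≃ (E → ZMod 2) :=
  Equiv.piCongrRight fun _ =>
    { toFun := fun b => if b then 1 else 0
      invFun := fun z => decide (z = 1)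
      left_inv := by decide
      right_inv := by decide }

theorem colorVector_switch {X : Type*} (G : Multigraph X E) (x : X) (c : E → Bool) :
    colorVector (switch (G.edgesOnceAt x) c) = colorVector c + G.incidenceRow x := by
  classical
  funext e
  rw [Pi.add_apply, Multigraph.incidenceRow_eq_indicator]
  have h : ∀ (p : Prop) [Decidable p] (b : Bool),
      (if (if p then !b else b) = true then (1 : ZMod 2) else 0) =
        (if b = true then 1 else 0) + if p then 1 else 0 := by
    intro p _ b
    by_cases hp : p <;> cases b <;> simp [hp, CharTwo.add_self_eq_zero]
  exact h _ _

theorem coloringSetoid_iff (c c' : E → Bool) :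
    M.coloringSetoid c c' ↔ colorVector c' - colorVector c ∈ M.U ⊔ M.Ustar := by
  constructor
  · intro h
    change Relation.ReflTransGen M.Move c c' at h
    induction h with
    | refl => simp
    | tail _ h ih =>
      cases h with
      | vertex v c =>
        rw [colorVector_switch, add_sub_right_comm]
        exact add_mem ih (Submodule.mem_sup_left (Submodule.subset_span ⟨v, rfl⟩))
      | face f c =>
        rw [colorVector_switch, add_sub_right_comm]
        exact add_mem ih (Submodule.mem_sup_right (Submodule.subset_span ⟨f, rfl⟩))
  · intro h
    -- Induction on the span: adding a row of either incidence matrix is one move.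
    have key : ∀ w ∈ M.U ⊔ M.Ustar, ∀ c c', colorVector c' = colorVector c + w →
        Relation.ReflTransGen M.Move c c' := by
      intro w hw
      rw [U, Ustar, Multigraph.cocycleSpace, Multigraph.cocycleSpace, ← Submodule.span_union] at hw
      induction hw using Submodule.span_induction with
      | mem w hw =>
        intro c c' h
        rcases hw with ⟨v, rfl⟩ | ⟨f, rfl⟩
        · rw [← colorVector_switch, EmbeddingLike.apply_eq_iff_eq] at h
          exact h ▸ Relation.ReflTransGen.single (Move.vertex v c)
        · rw [← colorVector_switch, EmbeddingLike.apply_eq_iff_eq] at h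
          exact h ▸ Relation.ReflTransGen.single (Move.face f c)
      | zero =>
        intro c c' h
        rw [add_zero, EmbeddingLike.apply_eq_iff_eq] at h
        exact h ▸ Relation.ReflTransGen.refl
      | add x y _ _ hx hy =>
        intro c c' h
        refine (hx c (colorVector.symm (colorVector c + x)) (by simp)).trans
          (hy _ c' (by simp [h, add_assoc]))
      | smul a x _ hx =>
        intro c c' h
        have ha : a = 0 ∨ a = 1 := by
          clear h
          revert a
          decide
        rcases ha with rfl | rfl
        · rw [zero_smul, add_zero, EmbeddingLike.apply_eq_iff_eq] at h
          exact h ▸ Relation.ReflTransGen.refl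
        · exact hx c c' (by rw [h, one_smul])
    exact key _ h c c' (by simp)

theorem card_coloring_classes [Finite E] :
    Nat.card (Quotient M.coloringSetoid) =
      2 ^ Module.finrank (ZMod 2) ((E → ZMod 2) ⧸ (M.U ⊔ M.Ustar)) := by
  have e : Quotient M.coloringSetoid ≃ ((E → ZMod 2) ⧸ (M.U ⊔ M.Ustar)) :=
    Quotient.congr colorVector fun c c' => by
      rw [Submodule.quotientRel_def, ← neg_sub, Submodule.neg_mem_iff]
      exact M.coloringSetoid_iff c c'
  rw [Nat.card_congr e, Module.natCard_eq_pow_finrank (K := ZMod 2), Nat.card_zmod]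

/-! ### Straight-ahead curves in the medial graph and the space `U ∩ U*` -/

/-- An element of `P` is given by a `GF(2)`-valued function of the medial components: its value
at an edge is the sum of the two values along the strands that cross there. -/
theorem mem_P_iff [Finite E] {y : E → ZMod 2} :
    y ∈ M.P ↔ ∃ c : M.MedialComponent → ZMod 2, ∀ e,
      y e = c (M.medialComponent ((e, true), true)) + c (M.medialComponent ((e, true), false)) := by
  classical
  have : Finite M.MedialComponent :=
    inferInstanceAs (Finite (Quot M.MedialStep))
  have := Fintype.ofFinite M.MedialComponent
  rw [P, Submodule.mem_span_range_iff_exists_fun]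
  refine exists_congr fun c => ?_
  rw [funext_iff]
  refine forall_congr' fun e => ?_
  have h : ∀ s, M.medialComponent ((e, false), s) = M.medialComponent ((e, true), s) :=
    fun s => Quot.sound (MedialStep.straight (e, false) s)
  rw [eq_comm, Finset.sum_apply]
  simp only [Pi.smul_apply, medialVector, smul_eq_mul, Fintype.sum_bool, mul_add, h,
    Finset.sum_add_distrib, mul_ite, mul_one, mul_zero, Finset.sum_ite_eq, Finset.mem_univ,
    if_true]

section

variable [Fintype V] [Fintype E] [Fintype F]

/-- If `w` is the coboundary of `α` on the graph and of `β` on the dual graph, then the function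
`α v + β f` of the corners `(v, f)` is constant along the components of the medial graph, and
the two strands at an edge `e` carry values with sum `w e`. -/
theorem U_inf_Ustar_le_P : M.U ⊓ M.Ustar ≤ M.P := by
  rintro w ⟨hw, hw'⟩
  obtain ⟨α, hα⟩ := M.graph.exists_coboundary hw
  obtain ⟨β, hβ⟩ := M.dual.exists_coboundary hw'
  let κ : (E × Bool) × Bool → ZMod 2 := fun x =>
    α (M.origin x.1) + β (M.face (if x.2 then x.1 else oppDart x.1))
  have hκ : ∀ x y, M.MedialStep x y → κ x = κ y := by
    rintro _ _ (d | ⟨d, s⟩)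
    · simp [κ, M.origin_rot, M.face_oppDart_rot]
    · have h1 := M.graph_coboundary_dart α d
      have h2 := M.dual_coboundary_dart β d
      rw [hα] at h1
      rw [hβ, h1] at h2
      cases s
      · simp only [κ, Bool.false_eq_true, if_false, oppDart_oppDart]
        linear_combination (norm := (ring_nf; try reduce_mod_char)) h2
      · simp only [κ, if_true]
        linear_combination (norm := (ring_nf; try reduce_mod_char)) h2
  refine M.mem_P_iff.2 ⟨Quot.lift κ hκ, fun e => ?_⟩
  change w e = κ ((e, true), true) + κ ((e, true), false)
  have h2 := M.dual_coboundary_dart β (e, true)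
  rw [hβ] at h2
  simp only [κ, Bool.false_eq_true, if_false, if_true]
  linear_combination (norm := (ring_nf; try reduce_mod_char)) h2

/-- Conversely, let an element of `P` be given by the values `κ` of the medial components, and
let it be the coboundary of a function `β` of the faces. Then `κ + β` is a function of the corners
which does not change under the rotation, hence a function of the vertices, and its coboundary is
the given vector. -/
theorem P_inf_Ustar_le_U : M.P ⊓ M.Ustar ≤ M.U := by
  rintro y ⟨hy, hy'⟩
  obtain ⟨c, hc⟩ := M.mem_P_iff.1 hy
  obtain ⟨β, hβ⟩ := M.dual.exists_coboundary hy'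
  let κ : E × Bool → Bool → ZMod 2 := fun d s => c (M.medialComponent (d, s))
  have hopp : ∀ d s, κ (oppDart d) s = κ d s := fun d s =>
    congrArg c (Quot.sound (MedialStep.straight d s)).symm
  have hrot : ∀ d, κ (M.rot d) false = κ d true := fun d =>
    congrArg c (Quot.sound (MedialStep.corner d)).symm
  have hsum : ∀ d : E × Bool, κ d true + κ d false =
      β (M.face d) + β (M.face (oppDart d)) := by
    intro d
    rw [← M.dual_coboundary_dart, hβ, hc]
    obtain ⟨e, b⟩ := d
    cases b
    · exact congrArg₂ _ (hopp (e, false) true).symm (hopp (e, false) false).symm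
    · rfl
  obtain ⟨α, hα⟩ := M.exists_eq_comp_origin (h := fun d => κ d true + β (M.face d)) fun d => by
    have h := hsum (M.rot d)
    rw [hrot, M.face_oppDart_rot] at h
    linear_combination (norm := (ring_nf; try reduce_mod_char)) h
  have h : M.graph.coboundary α = y := by
    funext e
    rw [M.graph_coboundary_dart α (e, true), hα, hα, hopp, ← hβ,
      M.dual_coboundary_dart β (e, true)]
    linear_combination (norm := (ring_nf; try reduce_mod_char))
  exact h ▸ M.graph.coboundary_mem α

theorem P_inf_Ustar : M.P ⊓ M.Ustar = M.U ⊓ M.Ustar :=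
  le_antisymm (le_inf M.P_inf_Ustar_le_U inf_le_right)
    (le_inf M.U_inf_Ustar_le_P inf_le_right)

end

/-! ### Cellular homology -/

theorem mem_ker_boundary₁_iff [Fintype E] {u : E → ZMod 2} :
    u ∈ LinearMap.ker M.boundary₁ ↔ u ∈ orth M.U := by
  refine ⟨fun hu w hw => ?_, fun hu => M.orth_U_le hu⟩
  induction hw using Submodule.span_induction with
  | mem w hw =>
    obtain ⟨v, rfl⟩ := hw
    have h := congrFun (LinearMap.mem_ker.1 hu) v
    rw [Pi.zero_apply] at h
    rw [← h]
    exact Finset.sum_congr rfl fun e _ => mul_comm _ _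
  | zero => exact zero_dotProduct _
  | add x y _ _ hx hy => rw [add_dotProduct, hx, hy, add_zero]
  | smul c x _ hx => rw [smul_dotProduct, hx, smul_zero]

theorem range_boundary₂ [Fintype F] : LinearMap.range M.boundary₂ = M.Ustar := by
  ext w
  rw [LinearMap.mem_range, Ustar, Multigraph.cocycleSpace,
    Submodule.mem_span_range_iff_exists_fun]
  refine exists_congr fun β => ?_
  rw [show M.boundary₂ β = ∑ f, β f • M.dual.incidenceRow f from
    funext fun e => by rw [Finset.sum_apply]; rfl]

variable [Fintype E] [Fintype F]

theorem φ_eq_zero_iff (u : orth M.U) : M.φ u = 0 ↔ (u : E → ZMod 2) ∈ M.Ustar := by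
  rw [φ, LinearMap.comp_apply, Submodule.mkQ_apply, Submodule.Quotient.mk_eq_zero,
    Submodule.mem_comap, range_boundary₂]
  rfl

theorem φ_surjective : Function.Surjective M.φ := by
  intro x
  obtain ⟨u, rfl⟩ := Submodule.mkQ_surjective _ x
  exact ⟨⟨u.1, M.mem_ker_boundary₁_iff.1 u.2⟩, rfl⟩

theorem map_ker_φP : (LinearMap.ker M.φP).map M.P.subtype = M.P ⊓ M.Ustar := by
  ext y
  constructor
  · rintro ⟨x, hx, rfl⟩
    exact ⟨x.2, (M.φ_eq_zero_iff _).1 hx⟩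
  · rintro ⟨hy, hy'⟩
    exact ⟨⟨y, hy⟩, (M.φ_eq_zero_iff (Submodule.inclusion M.P_le_orth_U ⟨y, hy⟩)).2 hy', rfl⟩

variable [Fintype V]

/-- The intersection numbers with the fundamental cycles `p j` of the co-tree are coordinates on
the first homology group. They are injective: a cycle of the graph can be modified by a boundary so
as to vanish on the co-tree, and if its coordinates are zero, then it is supported in the tree and
hence vanishes. They are surjective, because the fundamental cycles of the tree form a dual
basis. -/
theorem TreeCotree.exists_coordinates {M : CellularEmbedding V E F} (t : M.TreeCotree)
    (p : t.Rest → E → ZMod 2) (hp : ∀ j, M.dual.IsCycleIn t.cotree j.1 (p j)) :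
    ∃ ψ : M.H₁ ≃ₗ[ZMod 2] (t.Rest → ZMod 2),
      ∀ (u : orth M.U) (j : t.Rest), ψ (M.φ u) j = p j ⬝ᵥ (u : E → ZMod 2) := by
  classical
  have : Finite t.Rest := Subtype.finite
  have := Fintype.ofFinite t.Rest
  have hp1 : ∀ j, p j j.1 = 1 := fun j =>
    t.isSpanningTree_cotree.apply_eq_one_of_isCycleIn (hp j)
  -- On vectors that vanish on the co-tree, the coordinates are the values at the remaining edges.
  have hpair : ∀ (j : t.Rest) (u : E → ZMod 2), (∀ e ∈ t.cotree, u e = 0) →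
      p j ⬝ᵥ u = u j.1 := by
    intro j u hu
    rw [dotProduct, Finset.sum_eq_single j.1, hp1, one_mul]
    · intro e _ hej
      by_cases he : p j e = 0
      · rw [he, zero_mul]
      · rw [hu e (((hp j).2.2 e he).resolve_right hej), mul_zero]
    · exact fun h => absurd (Finset.mem_univ _) h
  let L : (E → ZMod 2) →ₗ[ZMod 2] (t.Rest → ZMod 2) :=
    { toFun := fun u j => p j ⬝ᵥ u
      map_add' := fun u v => funext fun j => dotProduct_add _ _ _
      map_smul' := fun c u => funext fun j => dotProduct_smul _ _ _ }
  have hL : ∀ u ∈ M.Ustar, L u = 0 := fun u hu =>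
    funext fun j => (dotProduct_comm _ _).trans ((hp j).1 u hu)
  let ψ : M.H₁ →ₗ[ZMod 2] (t.Rest → ZMod 2) :=
    Submodule.liftQ _ (L.comp (LinearMap.ker M.boundary₁).subtype) fun u hu =>
      hL u (M.range_boundary₂ ▸ hu)
  have hψ : ∀ u : orth M.U, ψ (M.φ u) = L u := fun u => Submodule.liftQ_apply _ _ _
  have hbij : Function.Bijective ψ := by
    constructor
    · rw [← LinearMap.ker_eq_bot, LinearMap.ker_eq_bot']
      intro x hx
      obtain ⟨u, rfl⟩ := M.φ_surjective x
      rw [hψ] at hx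
      rw [M.φ_eq_zero_iff]
      obtain ⟨w, hw, hwu⟩ := t.isSpanningTree_cotree.exists_cocycle_eqOn u
      have hC : ∀ e ∈ t.cotree, (u.1 - w) e = 0 := fun e he => by
        rw [Pi.sub_apply, hwu e he, sub_self]
      have h0 : u.1 - w = 0 := by
        refine Multigraph.cycle_eq_zero t.isSpanningTree_tree.2
          (sub_mem u.2 (M.Ustar_le_orth_U hw)) fun e he => ?_
        by_contra heT
        have heC : e ∉ t.cotree := fun h => he (hC e h)
        refine he ?_
        rw [← hpair ⟨e, heT, heC⟩ _ hC, dotProduct_sub, sub_eq_zero]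
        exact (congrFun hx ⟨e, heT, heC⟩).trans (congrFun (hL w hw) ⟨e, heT, heC⟩).symm
      rwa [sub_eq_zero.1 h0]
    · intro a
      have hq : ∀ j : t.Rest, ∃ q ∈ orth M.U, q j.1 = 1 ∧ ∀ e, q e ≠ 0 → e ∈ t.tree ∪ {j.1} :=
        fun j => t.isSpanningTree_tree.exists_fundamental_cycle j.2.1
      choose q hq hq1 hqs using hq
      have hqC : ∀ j, ∀ e ∈ t.cotree, q j e = 0 := by
        intro j e he
        by_contra h
        rcases hqs j e h with h | rfl
        · exact Set.disjoint_left.1 t.disjoint h he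
        · exact j.2.2 he
      have hqR : ∀ i j : t.Rest, i ≠ j → q i j.1 = 0 := by
        intro i j hij
        by_contra h
        rcases hqs i j.1 h with h | h
        · exact j.2.1 h
        · exact hij (Subtype.ext h).symm
      refine ⟨M.φ ⟨∑ i, a i • q i, Submodule.sum_mem _ fun i _ =>
        Submodule.smul_mem _ _ (hq i)⟩, ?_⟩
      rw [hψ]
      funext j
      refine (hpair j _ fun e he => ?_).trans ?_
      · simp [hqC _ e he]
      · change (∑ i, a i • q i) j.1 = a j
        rw [Finset.sum_apply, Finset.sum_eq_single j]
        · simp [hq1]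
        · intro i _ hij
          simp [hqR i j hij]
        · exact fun h => absurd (Finset.mem_univ _) h
  exact ⟨LinearEquiv.ofBijective ψ hbij, fun u j => congrFun (hψ u) j⟩

theorem finrank_ker_φP :
    Module.finrank (ZMod 2) (LinearMap.ker M.φP) = Module.finrank (ZMod 2) ↥(M.U ⊓ M.Ustar) := by
  rw [← M.P_inf_Ustar, ← M.map_ker_φP]
  exact (Submodule.equivMapOfInjective _ M.P.injective_subtype _).finrank_eq

end CellularEmbedding

theorem mainTheorem1 {V E F : Type*} [Fintype V] [Fintype E] [Fintype F]
    (M : CellularEmbedding V E F) :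
    -- the surface has genus `M.genus`
    M.eulerChar = 2 - 2 * (M.genus : ℤ) ∧
    -- the number of equivalence classes in the color changing game
    Nat.card (Quotient M.coloringSetoid) =
      2 ^ (2 * M.genus + Module.finrank (ZMod 2) (LinearMap.ker M.φP)) ∧
    -- the equivalent formulation by dimensions
    Module.finrank (ZMod 2) ((E → ZMod 2) ⧸ (M.U ⊔ M.Ustar)) =
      2 * M.genus + Module.finrank (ZMod 2) ↥(M.U ⊓ M.Ustar) ∧
    (LinearMap.ker M.φP).map M.P.subtype = M.U ⊓ M.Ustar ∧
    -- the map `φ` in the coordinates given by any tree and co-tree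
    Nonempty M.TreeCotree ∧
    ∀ t : M.TreeCotree,
      Nat.card t.Rest = 2 * M.genus ∧
      (∀ j : t.Rest, ∃! p : E → ZMod 2, M.dual.IsCycleIn t.cotree j.1 p) ∧
      ∀ p : t.Rest → E → ZMod 2, (∀ j, M.dual.IsCycleIn t.cotree j.1 (p j)) →
        ∃ ψ : M.H₁ ≃ₗ[ZMod 2] (t.Rest → ZMod 2),
          ∀ (u : orth M.U) (j : t.Rest), ψ (M.φ u) j = p j ⬝ᵥ (u : E → ZMod 2) := by
  refine ⟨M.eulerChar_eq, ?_, M.finrank_quotient_sup, M.map_ker_φP.trans M.P_inf_Ustar,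
    M.nonempty_treeCotree, fun t => ⟨t.card_rest_eq_two_mul_genus,
      fun j => t.isSpanningTree_cotree.existsUnique_isCycleIn j.2.2, t.exists_coordinates⟩⟩
  rw [M.card_coloring_classes, M.finrank_quotient_sup, M.finrank_ker_φP]
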